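/- Let $p$ be a prime number and let $W$ be the ring scheme of ($p$-typical) Witt vectors, with underlying scheme $\operatorname{Spec}\mathbb{Z}[Z_0,Z_1,Z_2,\dots]$, so that $W(T)=W(\Gamma(T,\mathcal{O}_T))$ for every scheme $T$. Let $\mathbb{A}^1=\operatorname{Spec}\mathbb{Z}[\Lambda]$ be the affine line over the integers and let $i:\operatorname{Spec}\mathbb{Z}\hookrightarrow\mathbb{A}^1$ be the closed immersion given by $\Lambda=0$. Let $\mathbb{A}^1_{\mathrm{fl}}$ be the small flat site of $\mathbb{A}^1$: its objects are the $\mathbb{A}^1$-schemes that are flat and locally of finite presentation, and its coverings are the jointly surjective families of flat morphisms locally of finite presentation. (1) Let $\mathcal{G}^\Lambda=\operatorname{Spec}\mathbb{Z}[\Lambda]\bigl[X,\tfrac{1}{1+\Lambda X}\bigr]$. Then $\mathcal{G}^\Lambda$ is flat over $\mathbb{A}^1$ and has a structure of commutative group scheme over $\mathbb{A}^1$ for which $\alpha^\Lambda:\mathcal{G}^\Lambda\to\mathbb{G}_m$, $x\mapsto 1+\Lambda x$, is a morphism of group schemes, and, together with the canonical (restriction) morphism $\mathbb{G}_m\to i_*\mathbb{G}_m$,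 it gives an exact sequence of abelian sheaves on $\mathbb{A}^1_{\mathrm{fl}}$ $$0\longrightarrow\mathcal{G}^\Lambda\stackrel{\alpha^\Lambda}{\longrightarrow}\mathbb{G}_m\longrightarrow i_*\mathbb{G}_m\longrightarrow 0.$$ (2) Let $W^\Lambda$ be the scheme underlying $W$ over $\mathbb{A}^1$. Then $W^\Lambda$ is flat over $\mathbb{A}^1$ and has a structure of $W$-module scheme over $\mathbb{A}^1$ for which the morphism $$\Lambda:W^\Lambda\to W,\qquad x=(x_0,x_1,x_2,\dots)\mapsto\Lambda.x:=(\Lambda x_0,\Lambda x_1,\Lambda x_2,\dots)$$ is a morphism of $W$-module schemes, and, together with the canonical (restriction) morphism $W\to i_*W$, it gives an exact sequence of abelian sheaves on $\mathbb{A}^1_{\mathrm{fl}}$ $$0\longrightarrow W^\Lambda\stackrel{\Lambda}{\longrightarrow}W\longrightarrow i_*W\longrightarrow 0.$$ -/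

import Mathlib

open CategoryTheory Limits AlgebraicGeometry Opposite

namespace FlatSheaves

noncomputable section

/-! ### The small flat site -/

/-- Morphisms of schemes that are flat and locally of finite presentation. -/
abbrev FlatLFP : MorphismProperty Scheme.{0} :=
  @Flat ⊓ @LocallyOfFinitePresentation

instance : FlatLFP.IsStableUnderBaseChange :=
  MorphismProperty.IsStableUnderBaseChange.inf

instance {S T : Scheme.{0}} (f : S ⟶ T) : FlatLFP.IsStableUnderBaseChangeAlong f where
  of_isPullback h hg := MorphismProperty.of_isPullback h hg

/-- The underlying category of the small flat site of `S`: the full subcategory of the category of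
`S`-schemes on those that are flat and locally of finite presentation over `S`. -/
abbrev FlatSite (S : Scheme.{0}) : Type 1 :=
  FlatLFP.Over ⊤ S

/-- The topology of the small flat site: coverings are the jointly surjective families of
flat morphisms locally of finite presentation. -/
abbrev flatTopology (S : Scheme.{0}) : GrothendieckTopology (FlatSite S) :=
  S.smallGrothendieckTopology (Q := FlatLFP) FlatLFP

/-- A presheaf of abelian groups on the category of all `S`-schemes, restricted to the small
flat site. The universe lift puts the values in the universe of the objects of the site,
so that the sheaves of abelian groups on the site form an abelian category. -/
def restrictFlat {S : Scheme.{0}} (F : (Over S)ᵒᵖ ⥤ AddCommGrpCat.{0}) :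
    (FlatSite S)ᵒᵖ ⥤ AddCommGrpCat.{1} :=
  (MorphismProperty.Over.forget FlatLFP ⊤ S).op ⋙ F ⋙ AddCommGrpCat.uliftFunctor.{1, 0}

/-- The morphism on the small flat site induced by a morphism of presheaves
on all `S`-schemes. -/
def restrictFlatMap {S : Scheme.{0}} {F G : (Over S)ᵒᵖ ⥤ AddCommGrpCat.{0}} (f : F ⟶ G) :
    restrictFlat F ⟶ restrictFlat G :=
  Functor.whiskerLeft _ (Functor.whiskerRight f _)

/-- A functor of points defined on all schemes, viewed on `S`-schemes. -/
abbrev overBase (S : Scheme.{0}) (F : Scheme.{0}ᵒᵖ ⥤ AddCommGrpCat.{0}) :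
    (Over S)ᵒᵖ ⥤ AddCommGrpCat.{0} :=
  (Over.forget S).op ⋙ F

/-- The direct image `i_* F` along `i : Z ⟶ S`, given by `(i_* F)(U) = F(U ×_S Z)`. -/
def directImage {Z S : Scheme.{0}} (i : Z ⟶ S) (F : (FlatSite Z)ᵒᵖ ⥤ AddCommGrpCat.{1}) :
    (FlatSite S)ᵒᵖ ⥤ AddCommGrpCat.{1} :=
  (MorphismProperty.Over.pullback FlatLFP ⊤ i).op ⋙ F

/-- The canonical morphism `F ⟶ i_* F` attached to a functor of points `F` on all schemes:
over `U` it is the restriction `F(U) ⟶ F(U ×_S Z)` along the projection `U ×_S Z ⟶ U`. -/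
def toDirectImage {Z S : Scheme.{0}} (i : Z ⟶ S) (F : Scheme.{0}ᵒᵖ ⥤ AddCommGrpCat.{0}) :
    restrictFlat (overBase S F) ⟶ directImage i (restrictFlat (overBase Z F)) where
  app U := AddCommGrpCat.uliftFunctor.{1, 0}.map (F.map (pullback.fst U.unop.hom i).op)
  naturality U V f := by
    dsimp only [restrictFlat, directImage, overBase, Functor.comp_map, Functor.comp_obj]
    rw [← Functor.map_comp, ← Functor.map_comp]
    erw [← F.map_comp, ← F.map_comp]
    congr 2
    apply Quiver.Hom.unop_inj
    exact (pullback.lift_fst _ _ _).symm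

/-- `0 ⟶ F ⟶ G ⟶ H ⟶ 0` is an exact sequence of abelian sheaves for the topology `J`: the three
presheaves are sheaves, and the sequence is short exact in the category of abelian sheaves. -/
def IsShortExactSequenceOfSheaves {C : Type 1} [Category.{0} C] (J : GrothendieckTopology C)
    {F G H : Cᵒᵖ ⥤ AddCommGrpCat.{1}} (f : F ⟶ G) (g : G ⟶ H) : Prop :=
  ∃ (hF : Presheaf.IsSheaf J F) (hG : Presheaf.IsSheaf J G) (hH : Presheaf.IsSheaf J H)
    (hfg : f ≫ g = 0),
    (ShortComplex.mk (X₁ := (⟨F, hF⟩ : Sheaf J AddCommGrpCat.{1}))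
      (X₂ := (⟨G, hG⟩ : Sheaf J AddCommGrpCat.{1}))
      (X₃ := (⟨H, hH⟩ : Sheaf J AddCommGrpCat.{1})) (ObjectProperty.homMk f)
      (ObjectProperty.homMk g) (by ext1; exact hfg)).ShortExact

/-! ### The affine line and its origin -/

/-- The affine line `Spec ℤ[Λ]`. -/
abbrev affineLine : Scheme.{0} := Spec (CommRingCat.of (Polynomial ℤ))

/-- The closed immersion `Spec ℤ ⟶ Spec ℤ[Λ]` given by `Λ = 0`. -/
def origin : Spec (CommRingCat.of ℤ) ⟶ affineLine :=
  Spec.map (CommRingCat.ofHom (Polynomial.evalRingHom (0 : ℤ)))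

/-- The function `Λ` on a scheme over the affine line. -/
def lam (T : Over affineLine) : Γ(T.left, ⊤) :=
  T.hom.appTop ((Scheme.ΓSpecIso (CommRingCat.of (Polynomial ℤ))).inv Polynomial.X)

/-! ### The multiplicative group and `𝒢^Λ` -/

/-- The multiplicative group `T ↦ Γ(T, 𝒪_T)ˣ`, written additively. -/
def multiplicativeGroup : Scheme.{0}ᵒᵖ ⥤ AddCommGrpCat.{0} where
  obj T := AddCommGrpCat.of (Additive (Γ(T.unop, ⊤))ˣ)
  map f := AddCommGrpCat.ofHom (MonoidHom.toAdditive (Units.map f.unop.appTop.hom.toMonoidHom))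
  map_id T := by
    apply AddCommGrpCat.hom_ext
    apply AddMonoidHom.ext
    intro x
    apply Additive.toMul.injective
    apply Units.ext
    simp
  map_comp f g := by
    apply AddCommGrpCat.hom_ext
    apply AddMonoidHom.ext
    intro x
    apply Additive.toMul.injective
    apply Units.ext
    simp
    rfl

open scoped MonObj in
/-- The presheaf of points `T ↦ Hom_S(T, G)` of a commutative group scheme `G` over `S`,
written additively. -/
def pointsOfGroupScheme {S : Scheme.{0}} (G : Over S) [CommGrpObj G] :
    (Over S)ᵒᵖ ⥤ AddCommGrpCat.{0} where
  obj T := AddCommGrpCat.of (Additive (T.unop ⟶ G))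
  map f := AddCommGrpCat.ofHom (MonoidHom.toAdditive
    { toFun := fun x => f.unop ≫ x
      map_one' := MonObj.comp_one _
      map_mul' := fun x y => MonObj.comp_mul _ x y })
  map_id T := by ext x; apply Additive.toMul.injective; simp
  map_comp f g := by ext x; apply Additive.toMul.injective; simp

/-- The ring `ℤ[Λ][X, 1 / (1 + ΛX)]`. -/
abbrev GLambdaRing : Type :=
  Localization.Away
    (1 + Polynomial.C Polynomial.X * Polynomial.X : Polynomial (Polynomial ℤ))

/-- The scheme `𝒢^Λ = Spec ℤ[Λ][X, 1 / (1 + ΛX)]` over the affine line. -/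
def GLambda : Over affineLine :=
  Over.mk (Spec.map (CommRingCat.ofHom (algebraMap (Polynomial ℤ) GLambdaRing)))

/-- The coordinate `X` of a point of `𝒢^Λ`. -/
def GLambda.coord {T : Over affineLine} (x : T ⟶ GLambda) : Γ(T.left, ⊤) :=
  x.left.appTop ((Scheme.ΓSpecIso (CommRingCat.of GLambdaRing)).inv
    (algebraMap (Polynomial (Polynomial ℤ)) GLambdaRing Polynomial.X))

/-! ### Witt vectors -/

variable (p : ℕ) [Fact p.Prime]

/-- The additive group of the ring scheme of Witt vectors, `T ↦ W(Γ(T, 𝒪_T))`. -/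
def wittGroup : Scheme.{0}ᵒᵖ ⥤ AddCommGrpCat.{0} where
  obj T := AddCommGrpCat.of (WittVector p Γ(T.unop, ⊤))
  map f := AddCommGrpCat.ofHom (WittVector.map (p := p) f.unop.appTop.hom).toAddMonoidHom
  map_id T := by ext x n; simp
  map_comp f g := by ext x n; simp [WittVector.map_coeff]; rfl

/-- The scheme underlying the ring scheme of Witt vectors over `S`: the affine space over `S`
with coordinates `Z₀, Z₁, Z₂, …`. -/
def wittScheme (S : Scheme.{0}) : Over S := Over.mk (𝔸(ℕ; S) ↘ S)

/-- The coordinate function `Zₙ` on the scheme of Witt vectors. -/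
def wittCoord (S : Scheme.{0}) (n : ℕ) : Γ((wittScheme S).left, ⊤) :=
  AffineSpace.coord S n

/-- The points `T ⟶ W` over `S` are the Witt vectors over `Γ(T, 𝒪_T)`: a point corresponds to
the Witt vector whose components are its coordinates. -/
def wittPoints {S : Scheme.{0}} (T : Over S) :
    (T ⟶ wittScheme S) ≃ WittVector p Γ(T.left, ⊤) where
  toFun x := WittVector.mk p fun n => x.left.appTop (wittCoord S n)
  invFun a := Over.homMk (AffineSpace.homOfVector T.hom a.coeff)
    (AffineSpace.homOfVector_over T.hom a.coeff)
  left_inv x := by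
    apply Over.OverMorphism.ext
    apply AffineSpace.hom_ext
    · exact (AffineSpace.homOfVector_over _ _).trans (Over.w x).symm
    · intro n
      exact AffineSpace.homOfVector_appTop_coord _ _ n
  right_inv a := by
    ext n
    exact AffineSpace.homOfVector_appTop_coord _ _ n

/-- The morphism `x = (x₀, x₁, x₂, …) ↦ Λ.x = (Λ x₀, Λ x₁, Λ x₂, …)` from the scheme `W` over
the affine line to itself. -/
def lambdaMul : wittScheme affineLine ⟶ wittScheme affineLine :=
  Over.homMk (AffineSpace.homOfVector (wittScheme affineLine).hom
    fun n => lam (wittScheme affineLine) * wittCoord affineLine n)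
    (AffineSpace.homOfVector_over _ _)

/-- On points, `lambdaMul` multiplies every component by `Λ`. -/
theorem wittPoints_comp_lambdaMul {T : Over affineLine} (x : T ⟶ wittScheme affineLine) (n : ℕ) :
    (wittPoints p T (x ≫ lambdaMul)).coeff n = lam T * (wittPoints p T x).coeff n := by
  change x.left.appTop (lambdaMul.left.appTop (wittCoord affineLine n)) =
    lam T * x.left.appTop (wittCoord affineLine n)
  have h1 : lambdaMul.left.appTop (wittCoord affineLine n) =
      lam (wittScheme affineLine) * wittCoord affineLine n :=
    AffineSpace.homOfVector_appTop_coord _ _ n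
  have h2 : x.left.appTop (lam (wittScheme affineLine)) = lam T := by
    unfold lam
    rw [← Over.w x]
    rfl
  rw [h1, ← h2]
  exact map_mul x.left.appTop.hom _ _

/-- The structure of a `W`-module scheme on an `S`-scheme `M`, where `W` is the ring scheme of
Witt vectors: a structure of module over the ring `W(T) = W(Γ(T, 𝒪_T))` on the set
of points `Hom_S(T, M)`, functorial in the `S`-scheme `T`. -/
structure WittModuleScheme {S : Scheme.{0}} (M : Over S) where
  /-- the addition on points -/
  addCommGroup : ∀ T : Over S, AddCommGroup (T ⟶ M)
  /-- the scalar multiplication on points -/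
  module : ∀ T : Over S, Module (WittVector p Γ(T.left, ⊤)) (T ⟶ M)
  /-- base change of points is additive -/
  comp_add : ∀ {T T' : Over S} (g : T' ⟶ T) (x y : T ⟶ M), g ≫ (x + y) = g ≫ x + g ≫ y
  /-- base change of points is compatible with scalar multiplication -/
  comp_smul : ∀ {T T' : Over S} (g : T' ⟶ T) (a : WittVector p Γ(T.left, ⊤)) (x : T ⟶ M),
    g ≫ (a • x) = WittVector.map (p := p) g.left.appTop.hom a • (g ≫ x)

variable {p} in
/-- The additive group of points of a `W`-module scheme. -/
def WittModuleScheme.points {S : Scheme.{0}} {M : Over S} (m : WittModuleScheme p M) :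
    (Over S)ᵒᵖ ⥤ AddCommGrpCat.{0} :=
  letI := m.addCommGroup
  { obj := fun T => AddCommGrpCat.of (T.unop ⟶ M)
    map := fun f => AddCommGrpCat.ofHom
      (AddMonoidHom.mk' (fun x => f.unop ≫ x) (m.comp_add f.unop))
    map_id := fun T => by ext x; simp
    map_comp := fun f g => by ext x; simp }

end

end FlatSheaves

namespace FlatSheaves

/-! ### Sheaves on the small flat site -/

/-! On a flat affine `U` with ring `A`, the element `Λ` is a nonzerodivisor (`isRegular_lam`), and
restriction of functions to the fibre over the origin is surjective with kernel `ΛA`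
(`fst_appTop_surjective`, `dvd_of_fst_appTop_eq_zero`). So a unit restricts to `1` exactly when it
is `1 + Λx`, and a Witt vector restricts to `0` exactly when its components are `Λxₙ`, the `x` and
`xₙ` being unique. Witt vectors on the fibre lift componentwise. Units lift only locally: if `b`,
`c` lift a unit and its inverse, then `bc + Λd = 1`, so `U` is covered by `D(b)`, where `b` is
invertible, and `D(Λ)`, over which the fibre is empty.

The group laws must exist over all `𝔸¹`-schemes, including those where `Λ` is a zero divisor and the
laws cannot be pulled back from `𝔾ₘ` or `W`. For `𝒢^Λ` the formula `x + y + Λxy` serves. For `W^Λ`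
the operations are computed over `A[X]` with the regular element `X` in place of `Λ`, and then
specialised (`ScaledWitt`).

The sheaf conditions come from representability and fppf descent on the big site. As `W` is not
locally of finite presentation, it is not an object of the small site; its sheaf property is
restricted along the continuous functor of `forget_isContinuous`. Exactness is reduced to affine
objects by `IsShortExactSequenceOfSheaves.of_basis`. -/

instance flatLFP_isMultiplicative : FlatLFP.IsMultiplicative where
  id_mem _ := ⟨inferInstance, inferInstance⟩
  comp_mem f g hf hg := ⟨MorphismProperty.comp_mem _ f g hf.1 hg.1,
    MorphismProperty.comp_mem _ f g hf.2 hg.2⟩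

instance forget_locallyCoverDense (S : Scheme.{0}) :
    (MorphismProperty.Over.forget FlatLFP ⊤ S).LocallyCoverDense
      (S.overGrothendieckTopology FlatLFP) :=
  Scheme.locallyCoverDense_of_le S le_rfl

theorem mem_flatTopology_iff {S : Scheme.{0}} {U : FlatSite S} (R : Sieve U) :
    R ∈ flatTopology S U ↔ R.functorPushforward (MorphismProperty.Over.forget FlatLFP ⊤ S) ∈
      S.overGrothendieckTopology FlatLFP _ :=
  Functor.mem_restrictedTopology_iff

/-- A covering sieve on the small flat site contains a covering by flat morphisms locally of
finite presentation. -/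
theorem generate_flat_mem {S : Scheme.{0}} {U : FlatSite S} {R : Sieve U}
    (hR : R ∈ flatTopology S U) :
    Sieve.ofArrows (fun k : (Σ V : FlatSite S, {j : V ⟶ U // R j ∧ FlatLFP j.left}) =>
      (MorphismProperty.Over.forget FlatLFP ⊤ S).obj k.1)
      (fun k => (MorphismProperty.Over.forget FlatLFP ⊤ S).map k.2.1) ∈
      S.overGrothendieckTopology FlatLFP _ := by
  rw [mem_flatTopology_iff, Scheme.mem_overGrothendieckTopology] at hR
  rw [Scheme.mem_overGrothendieckTopology]
  obtain ⟨𝒰, h, hle⟩ := hR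
  refine ⟨𝒰, h, ?_⟩
  rintro - - ⟨i⟩
  have p : FlatLFP (𝒰.X i ↘ S) := by
    rw [← comp_over (𝒰.f i) S]
    exact FlatLFP.comp_mem _ _ (𝒰.map_prop i) U.prop
  let V : FlatSite S := MorphismProperty.Over.mk ⊤ (𝒰.X i ↘ S) p
  let j : V ⟶ U := MorphismProperty.Over.homMk (𝒰.f i) (comp_over (𝒰.f i) S)
  have hj : R j := by
    have := hle _ _ ⟨i⟩
    exact (Sieve.mem_functorPushforward_iff_of_full_of_faithful
      (F := MorphismProperty.Over.forget FlatLFP ⊤ S) R j).1 this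
  exact Sieve.ofArrows_mk _ _
    (⟨V, j, hj, 𝒰.map_prop i⟩ : (Σ V : FlatSite S, {j : V ⟶ U // R j ∧ FlatLFP j.left}))

/-- The small flat site has fibre products along flat morphisms locally of finite presentation, and
they are fibre products of `S`-schemes. -/
theorem exists_lift_fibreProduct {S : Scheme.{0}} {U V Y : FlatSite S} (j : V ⟶ U)
    (hj : FlatLFP j.left) (h : Y ⟶ U) :
    ∃ (P : FlatSite S) (a : P ⟶ V) (b : P ⟶ Y), a ≫ j = b ≫ h ∧
      ∀ (W : Over S) (u : W ⟶ (MorphismProperty.Over.forget FlatLFP ⊤ S).obj V)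
        (v : W ⟶ (MorphismProperty.Over.forget FlatLFP ⊤ S).obj Y),
        u ≫ (MorphismProperty.Over.forget FlatLFP ⊤ S).map j =
          v ≫ (MorphismProperty.Over.forget FlatLFP ⊤ S).map h →
        ∃ c : W ⟶ (MorphismProperty.Over.forget FlatLFP ⊤ S).obj P,
          c ≫ (MorphismProperty.Over.forget FlatLFP ⊤ S).map a = u ∧
          c ≫ (MorphismProperty.Over.forget FlatLFP ⊤ S).map b = v := by
  have hwj : j.left ≫ U.hom = V.hom := MorphismProperty.Over.w j
  have hwh : h.left ≫ U.hom = Y.hom := MorphismProperty.Over.w h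
  let P : FlatSite S := MorphismProperty.Over.mk ⊤ (pullback.snd j.left h.left ≫ Y.hom)
    (FlatLFP.comp_mem _ _ (FlatLFP.pullback_snd _ _ hj) Y.prop)
  let a : P ⟶ V := MorphismProperty.Over.homMk (pullback.fst j.left h.left) (by
    change _ = pullback.snd j.left h.left ≫ Y.hom
    rw [← hwj, ← hwh]
    exact pullback.condition_assoc _)
  let b : P ⟶ Y := MorphismProperty.Over.homMk (pullback.snd j.left h.left) rfl
  refine ⟨P, a, b, ?_, fun W u v huv => ?_⟩
  · ext1
    exact pullback.condition
  · have e : u.left ≫ j.left = v.left ≫ h.left := congrArg CommaMorphism.left huv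
    refine ⟨Over.homMk (pullback.lift u.left v.left e) ?_, ?_, ?_⟩
    · change pullback.lift u.left v.left e ≫ pullback.snd j.left h.left ≫ Y.hom = _
      exact (pullback.lift_snd_assoc _ _ _ _).trans (Over.w v)
    · ext1
      exact pullback.lift_fst _ _ _
    · ext1
      exact pullback.lift_snd _ _ _

/-- Morphisms between objects of the small site need not be flat, so general fibre products leave
the site. Those along the flat members of a covering sieve stay in it, and these members already
generate a covering in the big site. -/
instance forget_isContinuous (S : Scheme.{0}) :
    (MorphismProperty.Over.forget FlatLFP ⊤ S).IsContinuous (flatTopology S)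
      (S.overGrothendieckTopology FlatLFP) where
  op_comp_isSheaf_of_types G U R hR x hx := by
    have hG := (isSheaf_iff_isSheaf_of_type _ _).1 G.2
    have hcov := generate_flat_mem hR
    -- Here `W` is an arbitrary `S`-scheme: compatibility of `x`, known only on the small site,
    -- reaches `W` through the fibre product of `V` and `Y`.
    have key {V Y : FlatSite S} (j : V ⟶ U) (hj : R j) (hjf : FlatLFP j.left) (h : Y ⟶ U)
        (hh : R h) (W : Over S) (u : W ⟶ (MorphismProperty.Over.forget FlatLFP ⊤ S).obj V)
        (v : W ⟶ (MorphismProperty.Over.forget FlatLFP ⊤ S).obj Y)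
        (huv : u ≫ (MorphismProperty.Over.forget FlatLFP ⊤ S).map j =
          v ≫ (MorphismProperty.Over.forget FlatLFP ⊤ S).map h) :
        G.obj.map u.op (x j hj) = G.obj.map v.op (x h hh) := by
      obtain ⟨P, a, b, hab, H⟩ := exists_lift_fibreProduct j hjf h
      obtain ⟨c, rfl, rfl⟩ := H W u v huv
      have := congrArg (G.obj.map c.op) (hx a b hj hh hab)
      rw [op_comp, op_comp, Functor.map_comp_apply, Functor.map_comp_apply]
      exact this
    have hsh := hG _ hcov
    rw [Sieve.ofArrows, ← Presieve.isSheafFor_iff_generate, Presieve.isSheafFor_arrows_iff] at hsh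
    obtain ⟨t, ht, htu⟩ := hsh (fun k => x k.2.1 k.2.2.1) (fun k l W u v huv =>
      key k.2.1 k.2.2.1 k.2.2.2 l.2.1 l.2.2.1 W u v huv)
    refine ⟨t, ?_, fun t' ht' => htu t' fun k => ht' k.2.1 k.2.2.1⟩
    intro Y h hh
    -- The gluing used only flat members of `R`; for an arbitrary `h` in `R` the values are compared
    -- on the pullback of that flat covering.
    refine (hG.isSeparated _ (GrothendieckTopology.pullback_stable _
      ((MorphismProperty.Over.forget FlatLFP ⊤ S).map h) hcov)).ext ?_
    intro W v hv
    obtain ⟨V, u, _, ⟨k⟩, huv⟩ := hv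
    rw [← key k.2.1 k.2.2.1 k.2.2.2 h hh W u v huv, ← ht k]
    dsimp
    simp only [← Functor.map_comp_apply, ← op_comp, huv]

/-- A sheaf on the big flat site over `S` restricts to a sheaf on the small flat site. -/
theorem restrictFlat_isSheaf {S : Scheme.{0}} (F : (Over S)ᵒᵖ ⥤ AddCommGrpCat.{0})
    (hF : Presieve.IsSheaf (S.overGrothendieckTopology FlatLFP) (F ⋙ forget AddCommGrpCat)) :
    Presheaf.IsSheaf (flatTopology S) (restrictFlat F) := by
  rw [Presheaf.isSheaf_iff_isSheaf_forget (s := forget AddCommGrpCat), isSheaf_iff_isSheaf_of_type]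
  have h := Functor.op_comp_isSheaf_of_isSheaf_type
    (MorphismProperty.Over.forget FlatLFP ⊤ S) (flatTopology S) hF
  have h' : Presieve.IsSheaf (flatTopology S) (_ ⋙ uliftFunctor.{1, 0}) :=
    Presieve.isSheaf_comp_uliftFunctor _ h
  exact h'

theorem overBase_isSheaf (S : Scheme.{0}) (F : Scheme.{0}ᵒᵖ ⥤ AddCommGrpCat.{0})
    (hF : Presieve.IsSheaf (Scheme.grothendieckTopology FlatLFP) (F ⋙ forget AddCommGrpCat)) :
    Presieve.IsSheaf (S.overGrothendieckTopology FlatLFP)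
      (overBase S F ⋙ forget AddCommGrpCat) :=
  Functor.op_comp_isSheaf_of_isSheaf_type (Over.forget S)
    (S.overGrothendieckTopology FlatLFP) hF

/-- The direct image already makes sense on the big site, where base change along `i` is continuous
because its left adjoint is cocontinuous. -/
theorem directImage_isSheaf {Z S : Scheme.{0}} (i : Z ⟶ S) (F : Scheme.{0}ᵒᵖ ⥤ AddCommGrpCat.{0})
    (hF : Presieve.IsSheaf (Scheme.grothendieckTopology FlatLFP) (F ⋙ forget AddCommGrpCat)) :
    Presheaf.IsSheaf (flatTopology S) (directImage i (restrictFlat (overBase Z F))) := by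
  have : (Over.pullback i).IsContinuous (S.overGrothendieckTopology FlatLFP)
      (Z.overGrothendieckTopology FlatLFP) :=
    (Over.mapPullbackAdj i).isContinuous_of_isCocontinuous _ _
  exact restrictFlat_isSheaf ((Over.pullback i).op ⋙ overBase Z F)
    (Functor.op_comp_isSheaf_of_isSheaf_type (Over.pullback i)
      (S.overGrothendieckTopology FlatLFP)
      (overBase_isSheaf Z F hF))

/-- This is the fppf topology, so the content is faithfully flat descent for morphisms of schemes.
-/
instance grothendieckTopology_subcanonical :
    (Scheme.grothendieckTopology FlatLFP).Subcanonical :=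
  inferInstanceAs Scheme.fppfTopology.Subcanonical

/-- A presheaf of groups whose underlying presheaf of sets is representable is a sheaf. -/
theorem isSheaf_of_representableBy {C : Type*} [Category C] {J : GrothendieckTopology C}
    [J.Subcanonical] {F : Cᵒᵖ ⥤ AddCommGrpCat.{0}} {X : C}
    (e : (F ⋙ forget AddCommGrpCat).RepresentableBy X) :
    Presieve.IsSheaf J (F ⋙ forget AddCommGrpCat) := by
  have := e.isRepresentable
  exact GrothendieckTopology.Subcanonical.isSheaf_of_isRepresentable _

/-- The restriction of an object of the small flat site to an open subscheme. -/
noncomputable def restrictOpen {S : Scheme.{0}} (U : FlatSite S) (V : U.left.Opens) : FlatSite S :=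
  MorphismProperty.Over.mk ⊤ (V.ι ≫ U.hom)
    (FlatLFP.comp_mem _ _ ⟨inferInstance, inferInstance⟩ U.prop)

/-- The inclusion of an open subscheme of an object of the small flat site. -/
noncomputable def restrictOpenHom {S : Scheme.{0}} (U : FlatSite S) (V : U.left.Opens) :
    restrictOpen U V ⟶ U :=
  MorphismProperty.Over.homMk V.ι rfl

/-- A family of open immersions covering `U` generates a covering sieve. -/
theorem mem_flatTopology {S : Scheme.{0}} {U : FlatSite S} (R : Sieve U)
    (h : ∀ x : U.left, ∃ (V : FlatSite S) (j : V ⟶ U), IsOpenImmersion j.left ∧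
      x ∈ Set.range j.left ∧ R j) : R ∈ flatTopology S U := by
  rw [mem_flatTopology_iff, Scheme.mem_overGrothendieckTopology]
  choose V j hj hx hR using h
  let cov : U.left.Cover (Scheme.precoverage FlatLFP) :=
    { I₀ := U.left
      X := fun x => (V x).left
      f := fun x => (j x).left
      mem₀ := by
        rw [Scheme.presieve₀_mem_precoverage_iff]
        exact ⟨fun x => ⟨x, hx x⟩, fun x => ⟨inferInstance, inferInstance⟩⟩ }
  let hcov : cov.Over S :=
    ⟨fun x => ⟨(V x).hom⟩, fun x => ⟨MorphismProperty.Over.w (j x)⟩⟩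
  refine ⟨cov, hcov, ?_⟩
  rintro - - ⟨x⟩
  exact ⟨V x, j x, 𝟙 _, hR x, by ext1; exact (Category.id_comp _).symm⟩

/-! ### Criteria for exactness of sequences of sheaves. -/

/-- A sequence of presheaves of abelian groups that are sheaves is a short exact sequence of
sheaves if it is left exact on sections and its second arrow is locally surjective. -/
theorem IsShortExactSequenceOfSheaves.of_sections {C : Type 1} [Category.{0} C]
    {J : GrothendieckTopology C} {F G H : Cᵒᵖ ⥤ AddCommGrpCat.{1}} (f : F ⟶ G) (g : G ⟶ H)
    (hF : Presheaf.IsSheaf J F) (hG : Presheaf.IsSheaf J G) (hH : Presheaf.IsSheaf J H)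
    (hf : ∀ U, Function.Injective (f.app U))
    (hfg : ∀ U (y : G.obj U), g.app U y = 0 ↔ ∃ x, f.app U x = y)
    (hg : Presheaf.IsLocallySurjective J g) :
    IsShortExactSequenceOfSheaves J f g := by
  have w : f ≫ g = 0 := by
    ext U x
    exact (hfg U _).2 ⟨x, rfl⟩
  refine ⟨hF, hG, hH, w, ?_⟩
  have hmono (U) : Mono (f.app U) := (AddCommGrpCat.mono_iff_injective _).2 (hf U)
  have hmono' : Mono f := NatTrans.mono_of_mono_app f
  set T := ShortComplex.mk (X₁ := (⟨F, hF⟩ : Sheaf J AddCommGrpCat.{1}))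
      (X₂ := (⟨G, hG⟩ : Sheaf J AddCommGrpCat.{1}))
      (X₃ := (⟨H, hH⟩ : Sheaf J AddCommGrpCat.{1})) (ObjectProperty.homMk f)
      (ObjectProperty.homMk g) (by ext1; exact w)
  have hT : Mono T.f := (sheafToPresheaf J _).mono_of_mono_map hmono'
  have hT' : Epi T.g := by
    have : Sheaf.IsLocallySurjective T.g := hg
    infer_instance
  -- The universal property of the kernel: preimages are chosen objectwise, and injectivity of `f`
  -- makes them additive and natural.
  have hlift {K : Cᵒᵖ ⥤ AddCommGrpCat.{1}} (k : K ⟶ G) (hk : k ≫ g = 0) :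
      ∃ l : K ⟶ F, l ≫ f = k := by
    have hk' (U) (y : K.obj U) : ∃ x, f.app U x = k.app U y := by
      rw [← hfg U]
      exact ConcreteCategory.congr_hom (congrArg (fun t => t.app U) hk) y
    choose l hl using hk'
    refine ⟨{ app := fun U => AddCommGrpCat.ofHom (AddMonoidHom.mk' (l U) fun y z => hf U ?_)
              naturality := fun U V i => ?_ }, ?_⟩
    · simp only [map_add, hl]
    · rw [← cancel_mono (f.app V)]
      ext y
      have h1 := hl V (K.map i y)
      have h2 := ConcreteCategory.congr_hom (f.naturality i) (l U y)
      have h3 := ConcreteCategory.congr_hom (k.naturality i) y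
      exact h1.trans (h3.trans ((congrArg (G.map i) (hl U y)).symm.trans h2.symm))
    · ext U y
      exact hl U y
  refine ShortComplex.ShortExact.mk (T.exact_of_f_is_kernel ?_)
  refine KernelFork.IsLimit.ofι _ _
    (fun k hk => ObjectProperty.homMk (hlift k.hom (congrArg (·.hom) hk)).choose) ?_ ?_
  · intro K k hk
    ext1
    exact (hlift k.hom (congrArg (·.hom) hk)).choose_spec
  · intro K k hk m hm
    rw [← cancel_mono T.f, hm]
    ext1
    exact (hlift k.hom (congrArg (·.hom) hk)).choose_spec.symm

/-- Exactness of a sequence of sheaves may be checked on a class of objects covering all objects. -/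
theorem IsShortExactSequenceOfSheaves.of_basis {C : Type 1} [Category.{0} C]
    {J : GrothendieckTopology C} {F G H : Cᵒᵖ ⥤ AddCommGrpCat.{1}} (f : F ⟶ G) (g : G ⟶ H)
    (hF : Presheaf.IsSheaf J F) (hG : Presheaf.IsSheaf J G) (hH : Presheaf.IsSheaf J H)
    (B : C → Prop)
    (hB : ∀ U, ∃ R ∈ J U, ∀ ⦃V⦄ (j : V ⟶ U), R j → ∃ W, B W ∧ ∃ (a : V ⟶ W) (b : W ⟶ U), a ≫ b = j)
    (hf : ∀ U, B U → Function.Injective (f.app (op U)))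
    (hfg : ∀ U, B U → ∀ y : G.obj (op U), g.app (op U) y = 0 ↔ ∃ x, f.app (op U) x = y)
    (hg : ∀ U, B U → ∀ y : H.obj (op U), Presheaf.imageSieve g y ∈ J U) :
    IsShortExactSequenceOfSheaves J f g := by
  have hF' := (isSheaf_iff_isSheaf_of_type _ _).1
    ((Presheaf.isSheaf_iff_isSheaf_forget J F (forget AddCommGrpCat)).1 hF)
  have hG' := (isSheaf_iff_isSheaf_of_type _ _).1
    ((Presheaf.isSheaf_iff_isSheaf_forget J G (forget AddCommGrpCat)).1 hG)
  have hH' := (isSheaf_iff_isSheaf_of_type _ _).1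
    ((Presheaf.isSheaf_iff_isSheaf_forget J H (forget AddCommGrpCat)).1 hH)
  have nat_f {U V : Cᵒᵖ} (i : U ⟶ V) (x : F.obj U) : f.app V (F.map i x) = G.map i (f.app U x) :=
    ConcreteCategory.congr_hom (f.naturality i) x
  have nat_g {U V : Cᵒᵖ} (i : U ⟶ V) (x : G.obj U) : g.app V (G.map i x) = H.map i (g.app U x) :=
    ConcreteCategory.congr_hom (g.naturality i) x
  have inj (U : Cᵒᵖ) : Function.Injective (f.app U) := by
    intro x x' hx
    obtain ⟨R, hR, hRB⟩ := hB U.unop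
    refine (hF'.isSeparated R hR).ext fun V j hj => ?_
    obtain ⟨W, hW, a, b, rfl⟩ := hRB j hj
    have h1 : F.map b.op x = F.map b.op x' := hf W hW (by rw [nat_f, nat_f, hx])
    change F.map (b.op ≫ a.op) x = F.map (b.op ≫ a.op) x'
    rw [Functor.map_comp_apply, Functor.map_comp_apply, h1]
  refine .of_sections f g hF hG hH inj (fun U y => ⟨fun hy => ?_, ?_⟩) ⟨fun {U} y => ?_⟩
  · obtain ⟨R, hR, hRB⟩ := hB U.unop
    have hloc (V : C) (j : V ⟶ U.unop) (hj : R j) : ∃ x, f.app (op V) x = G.map j.op y := by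
      obtain ⟨W, hW, a, b, rfl⟩ := hRB j hj
      obtain ⟨x, hx⟩ := (hfg W hW (G.map b.op y)).1 (by rw [nat_g, hy, map_zero])
      refine ⟨F.map a.op x, ?_⟩
      rw [nat_f, hx, op_comp, Functor.map_comp_apply]
    choose x hx using hloc
    -- Local preimages are unique by injectivity, hence agree on overlaps and glue.
    have hcompat : Presieve.FamilyOfElements.Compatible
        (P := F ⋙ forget AddCommGrpCat) (R := R.arrows) x := by
      intro V₁ V₂ W a₁ a₂ j₁ j₂ h₁ h₂ e
      refine inj _ ?_
      refine (nat_f a₁.op _).trans (Eq.trans ?_ (nat_f a₂.op _).symm)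
      rw [hx, hx, ← Functor.map_comp_apply, ← Functor.map_comp_apply, ← op_comp, ← op_comp, e]
    obtain ⟨t, ht, -⟩ := hF' R hR x hcompat
    refine ⟨t, (hG'.isSeparated R hR).ext fun V j hj => ?_⟩
    exact (nat_f j.op t).symm.trans ((congrArg (f.app (op V)) (ht j hj)).trans (hx V j hj))
  · rintro ⟨x, rfl⟩
    obtain ⟨R, hR, hRB⟩ := hB U.unop
    refine (hH'.isSeparated R hR).ext fun V j hj => ?_
    obtain ⟨W, hW, a, b, rfl⟩ := hRB j hj
    have h1 : H.map b.op (g.app U (f.app U x)) = 0 := by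
      rw [← nat_g, ← nat_f]
      exact (hfg W hW _).2 ⟨_, rfl⟩
    change H.map (b.op ≫ a.op) _ = H.map (b.op ≫ a.op) 0
    rw [Functor.map_comp_apply, h1, map_zero, map_zero]
  · obtain ⟨R, hR, hRB⟩ := hB U
    refine J.transitive hR _ fun V j hj => ?_
    obtain ⟨W, hW, a, b, rfl⟩ := hRB j hj
    rw [Sieve.pullback_comp]
    refine J.pullback_stable a ?_
    rw [Presheaf.pullback_imageSieve]
    exact hg W hW _

/-- Affine objects cover all objects of the small flat site. -/
theorem exists_affine_cover {S : Scheme.{0}} (U : FlatSite S) :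
    ∃ R ∈ flatTopology S U, ∀ ⦃V⦄ (j : V ⟶ U), R j →
      ∃ W : FlatSite S, IsAffine W.left ∧ ∃ (a : V ⟶ W) (b : W ⟶ U), a ≫ b = j := by
  refine ⟨⟨fun V j => ∃ W : FlatSite S, IsAffine W.left ∧ ∃ (a : V ⟶ W) (b : W ⟶ U), a ≫ b = j,
    ?_⟩, mem_flatTopology _ fun x => ?_, fun V j hj => hj⟩
  · rintro V V' _ ⟨W, hW, a, b, rfl⟩ i
    exact ⟨W, hW, i ≫ a, b, Category.assoc _ _ _⟩
  · obtain ⟨V, hV, hx, -⟩ := exists_isAffineOpen_mem_and_subset (X := U.left) (x := x) (U := ⊤) trivial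
    exact ⟨restrictOpen U V, restrictOpenHom U V, inferInstanceAs (IsOpenImmersion V.ι),
      by exact ⟨⟨x, hx⟩, rfl⟩, restrictOpen U V, hV, 𝟙 _, _, Category.id_comp _⟩

end FlatSheaves

namespace FlatSheaves

noncomputable section

/-! ### Witt vectors with components scaled by a ring element -/

/-- Sequences `x` in `A`, regarded as coordinates of the Witt vectors `(r x₀, r x₁, …)`. -/
def ScaledWitt (_p : ℕ) {A : Type*} [CommRing A] (_r : A) : Type _ := ℕ → A

namespace ScaledWitt

open Polynomial

variable {p : ℕ} {A B : Type*} [CommRing A] [CommRing B]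

@[ext]
theorem ext {r : A} {x y : ScaledWitt p r} (h : ∀ n, x n = y n) : x = y :=
  funext h

/-- The Witt vector `(r x₀, r x₁, …)`. -/
def scale {r : A} (x : ScaledWitt p r) : WittVector p A :=
  WittVector.mk p fun n => r * x n

theorem scale_injective {r : A} (hr : IsLeftRegular r) :
    Function.Injective (scale : ScaledWitt p r → WittVector p A) := by
  intro x y h
  ext n
  exact hr (congrArg (fun w => WittVector.coeff w n) h)

/-- Change of rings. -/
def map (f : A →+* B) {r : A} {s : B} (_h : f r = s) (x : ScaledWitt p r) : ScaledWitt p s :=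
  fun n => f (x n)

theorem evalRingHom_X (r : A) : evalRingHom r X = r := eval_X

/-- The lift of a sequence to the polynomial ring, where the scaling element is the variable. -/
def generic {r : A} (x : ScaledWitt p r) : ScaledWitt p (X : A[X]) :=
  fun n => C (x n)

theorem map_generic {r : A} (x : ScaledWitt p r) :
    map (evalRingHom r) (evalRingHom_X r) x.generic = x := by
  ext n
  exact eval_C

/-- The sequence with coordinates `x` for which `scale x` is a given Witt vector with components
divisible by the variable, specialised at `r`. -/
def unscale (r : A) (w : WittVector p A[X]) : ScaledWitt p r :=
  fun n => eval r (divX (w.coeff n))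

instance (r : A) : Zero (ScaledWitt p r) := ⟨fun _ => 0⟩

theorem map_zero (f : A →+* B) {r : A} {s : B} (h : f r = s) : map f h (0 : ScaledWitt p r) = 0 :=
  ext fun _ => RingHom.map_zero f

theorem exists_map_eq {r : A} (x : ScaledWitt p r) :
    ∃ y : ScaledWitt p (X : A[X]), map (evalRingHom r) (evalRingHom_X r) y = x :=
  ⟨x.generic, x.map_generic⟩

theorem scale_X_injective :
    Function.Injective (scale : ScaledWitt p (X : A[X]) → WittVector p A[X]) :=
  scale_injective isRegular_X.left

variable [Fact p.Prime]

theorem scale_map (f : A →+* B) {r : A} {s : B} (h : f r = s) (x : ScaledWitt p r) :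
    (map f h x).scale = WittVector.map f x.scale := by
  ext n
  rw [WittVector.map_coeff]
  simp [scale, map, ← h]

/-- Division by the variable and evaluation commute with change of coefficients; functoriality of
the operations below rests on this. -/
theorem map_unscale (f : A →+* B) {r : A} {s : B} (h : f r = s) (w : WittVector p A[X]) :
    map f h (unscale r w) = unscale s (WittVector.map (mapRingHom f) w) := by
  ext n
  have h1 : divX (Polynomial.map f (w.coeff n)) = Polynomial.map f (divX (w.coeff n)) := by
    ext m
    simp [coeff_divX]
  simp [map, unscale, h1, ← h]

/-- A Witt vector has all components in `I` if and only if it vanishes modulo `I`. -/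
theorem coeff_mem_iff (I : Ideal A) (w : WittVector p A) :
    (∀ n, w.coeff n ∈ I) ↔ WittVector.map (Ideal.Quotient.mk I) w = 0 := by
  simp only [WittVector.ext_iff, WittVector.map_coeff, WittVector.zero_coeff,
    Ideal.Quotient.eq_zero_iff_mem]

/-- Divisibility of the components is phrased as vanishing in the Witt vectors of the quotient ring,
which ring operations visibly preserve. No Witt polynomial has to be inspected. -/
theorem scale_mem {r : A} (x : ScaledWitt p r) :
    WittVector.map (Ideal.Quotient.mk (Ideal.span {r})) x.scale = 0 := by
  rw [← coeff_mem_iff]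
  exact fun n => Ideal.mul_mem_right _ _ (Ideal.mem_span_singleton_self r)

theorem scale_unscale (r : A) (w : WittVector p A[X])
    (hw : WittVector.map (Ideal.Quotient.mk (Ideal.span {(X : A[X])})) w = 0) :
    (unscale r w).scale = WittVector.map (evalRingHom r) w := by
  rw [← coeff_mem_iff] at hw
  ext n
  obtain ⟨q, hq⟩ := Ideal.mem_span_singleton.1 (hw n)
  rw [WittVector.map_coeff]
  have h1 : divX (X * q) = q := by
    ext m
    simp [coeff_divX]
  simp [scale, unscale, hq, h1]

theorem eval_generic {r : A} (x : ScaledWitt p r) :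
    WittVector.map (evalRingHom r) x.generic.scale = x.scale := by
  rw [← scale_map _ (evalRingHom_X r), map_generic]

theorem scale_generic_map (f : A →+* B) {r : A} {s : B} (h : f r = s) (x : ScaledWitt p r) :
    (map f h x).generic.scale = WittVector.map (mapRingHom f) x.generic.scale := by
  rw [← scale_map (mapRingHom f) (Polynomial.map_X f)]
  refine congrArg scale (ScaledWitt.ext fun n => ?_)
  exact (Polynomial.map_C f).symm

/-- When `r` is a zero divisor, `scale` does not determine a sum. Over `A[X]` the scaled vectors add
up to a vector with components divisible by `X`; dividing by `X` and setting `X = r` selects a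
canonical answer. -/
instance (r : A) : Add (ScaledWitt p r) :=
  ⟨fun x y => unscale r (x.generic.scale + y.generic.scale)⟩

instance (r : A) : Neg (ScaledWitt p r) :=
  ⟨fun x => unscale r (-x.generic.scale)⟩

instance (r : A) : SMul (WittVector p A) (ScaledWitt p r) :=
  ⟨fun a x => unscale r (WittVector.map C a * x.generic.scale)⟩

variable {r : A} {s : B} (f : A →+* B) (h : f r = s)

theorem scale_zero : (0 : ScaledWitt p r).scale = 0 := by
  ext n
  rw [WittVector.zero_coeff]
  exact mul_zero r

theorem scale_add (x y : ScaledWitt p r) : (x + y).scale = x.scale + y.scale := by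
  change (unscale r _).scale = _
  rw [scale_unscale _ _ (by simp only [map_add, scale_mem, add_zero])]
  simp only [map_add, eval_generic]

theorem scale_neg (x : ScaledWitt p r) : (-x).scale = -x.scale := by
  change (unscale r _).scale = _
  rw [scale_unscale _ _ (by simp only [map_neg, scale_mem, neg_zero])]
  simp only [map_neg, eval_generic]

theorem scale_smul (a : WittVector p A) (x : ScaledWitt p r) : (a • x).scale = a * x.scale := by
  change (unscale r _).scale = _
  rw [scale_unscale _ _ (by simp only [map_mul, scale_mem, mul_zero])]
  simp only [map_mul, eval_generic]
  congr 1
  ext n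
  simp only [WittVector.map_coeff, coe_evalRingHom, eval_C]

theorem map_add (x y : ScaledWitt p r) : map f h (x + y) = map f h x + map f h y := by
  change map f h (unscale r _) = unscale s _
  simp only [map_unscale, scale_generic_map, _root_.map_add]

theorem map_neg (x : ScaledWitt p r) : map f h (-x) = -map f h x := by
  change map f h (unscale r _) = unscale s _
  simp only [map_unscale, scale_generic_map, _root_.map_neg]

theorem map_smul (a : WittVector p A) (x : ScaledWitt p r) :
    map f h (a • x) = WittVector.map f a • map f h x := by
  change map f h (unscale r _) = unscale s _
  simp only [map_unscale, scale_generic_map, _root_.map_mul]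
  congr 2
  ext n
  simp only [WittVector.map_coeff, coe_mapRingHom, Polynomial.map_C]

theorem exists_witt_map_eq (r : A) (a : WittVector p A) :
    ∃ b : WittVector p A[X], WittVector.map (evalRingHom r) b = a :=
  ⟨WittVector.map C a, by ext n; simp only [WittVector.map_coeff, coe_evalRingHom, eval_C]⟩

/-- Each axiom lifts to `A[X]`, where `scale` is injective and reduces it to the ring axioms of Witt
vectors; evaluation at `r` is compatible with the operations and brings it back. -/
instance : AddCommGroup (ScaledWitt p r) where
  add_assoc x y z := by
    obtain ⟨x, rfl⟩ := exists_map_eq x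
    obtain ⟨y, rfl⟩ := exists_map_eq y
    obtain ⟨z, rfl⟩ := exists_map_eq z
    simp only [← map_add]
    exact congrArg (map _ _) (scale_X_injective (by simp only [scale_add, add_assoc]))
  zero_add x := by
    obtain ⟨x, rfl⟩ := exists_map_eq x
    rw [← map_zero (evalRingHom r) (evalRingHom_X r), ← map_add]
    exact congrArg (map _ _) (scale_X_injective (by simp only [scale_add, scale_zero, zero_add]))
  add_zero x := by
    obtain ⟨x, rfl⟩ := exists_map_eq x
    rw [← map_zero (evalRingHom r) (evalRingHom_X r), ← map_add]
    exact congrArg (map _ _) (scale_X_injective (by simp only [scale_add, scale_zero, add_zero]))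
  add_comm x y := by
    obtain ⟨x, rfl⟩ := exists_map_eq x
    obtain ⟨y, rfl⟩ := exists_map_eq y
    simp only [← map_add]
    exact congrArg (map _ _) (scale_X_injective (by simp only [scale_add, add_comm]))
  neg_add_cancel x := by
    obtain ⟨x, rfl⟩ := exists_map_eq x
    rw [← map_zero (evalRingHom r) (evalRingHom_X r), ← map_neg, ← map_add]
    exact congrArg (map _ _) (scale_X_injective
      (by simp only [scale_add, scale_zero, scale_neg, neg_add_cancel]))
  nsmul := nsmulRec
  zsmul := zsmulRec

instance : Module (WittVector p A) (ScaledWitt p r) where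
  one_smul x := by
    obtain ⟨x, rfl⟩ := exists_map_eq x
    rw [← _root_.map_one (WittVector.map (evalRingHom r)), ← map_smul]
    exact congrArg (map _ _) (scale_X_injective (by simp only [scale_smul, one_mul]))
  mul_smul a b x := by
    obtain ⟨x, rfl⟩ := exists_map_eq x
    obtain ⟨a, rfl⟩ := exists_witt_map_eq r a
    obtain ⟨b, rfl⟩ := exists_witt_map_eq r b
    simp only [← _root_.map_mul, ← map_smul]
    exact congrArg (map _ _) (scale_X_injective (by simp only [scale_smul, mul_assoc]))
  smul_zero a := by
    obtain ⟨a, rfl⟩ := exists_witt_map_eq r a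
    rw [← map_zero (evalRingHom r) (evalRingHom_X r), ← map_smul]
    exact congrArg (map _ _) (scale_X_injective (by simp only [scale_smul, scale_zero, mul_zero]))
  smul_add a x y := by
    obtain ⟨x, rfl⟩ := exists_map_eq x
    obtain ⟨y, rfl⟩ := exists_map_eq y
    obtain ⟨a, rfl⟩ := exists_witt_map_eq r a
    simp only [← map_smul, ← map_add]
    exact congrArg (map _ _) (scale_X_injective (by simp only [scale_smul, scale_add, mul_add]))
  add_smul a b x := by
    obtain ⟨x, rfl⟩ := exists_map_eq x
    obtain ⟨a, rfl⟩ := exists_witt_map_eq r a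
    obtain ⟨b, rfl⟩ := exists_witt_map_eq r b
    simp only [← _root_.map_add, ← map_smul, ← map_add]
    exact congrArg (map _ _) (scale_X_injective (by simp only [scale_smul, scale_add, add_mul]))
  zero_smul x := by
    obtain ⟨x, rfl⟩ := exists_map_eq x
    rw [← _root_.map_zero (WittVector.map (evalRingHom r)), ← map_smul,
      ← map_zero (evalRingHom r) (evalRingHom_X r)]
    exact congrArg (map _ _) (scale_X_injective (by simp only [scale_smul, scale_zero, zero_mul]))

end ScaledWitt

/-! ### The group of `x` with `1 + r x` invertible -/

/-- The elements `x` of `A` for which `1 + r x` is invertible. -/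
def DeformedUnits {A : Type*} [CommRing A] (r : A) : Type _ := {x : A // IsUnit (1 + r * x)}

namespace DeformedUnits

variable {A B : Type*} [CommRing A] [CommRing B] {r : A}

/-- The law is read off from `(1 + rx)(1 + ry) = 1 + r(x + y + rxy)`; no division by `r` occurs, so
it makes sense for every `r`. -/
instance : Mul (DeformedUnits r) :=
  ⟨fun x y => ⟨x.1 + y.1 + r * x.1 * y.1, by
    have h : 1 + r * (x.1 + y.1 + r * x.1 * y.1) = (1 + r * x.1) * (1 + r * y.1) := by ring
    rw [h]
    exact x.2.mul y.2⟩⟩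

instance : One (DeformedUnits r) := ⟨⟨0, by simp⟩⟩

theorem one_add_mul_inv (x : DeformedUnits r) :
    1 + r * (-x.1 * (x.2.unit⁻¹ : Aˣ)) = (x.2.unit⁻¹ : Aˣ) := by
  have h := x.2.mul_val_inv
  linear_combination -h

instance : Inv (DeformedUnits r) :=
  ⟨fun x => ⟨-x.1 * (x.2.unit⁻¹ : Aˣ), by rw [one_add_mul_inv]; exact Units.isUnit _⟩⟩

instance : CommGroup (DeformedUnits r) where
  mul_assoc x y z := Subtype.ext (by
    change (x.1 + y.1 + r * x.1 * y.1) + z.1 + r * (x.1 + y.1 + r * x.1 * y.1) * z.1 =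
      x.1 + (y.1 + z.1 + r * y.1 * z.1) + r * x.1 * (y.1 + z.1 + r * y.1 * z.1)
    ring)
  one_mul x := Subtype.ext (by
    change 0 + x.1 + r * 0 * x.1 = x.1
    ring)
  mul_one x := Subtype.ext (by
    change x.1 + 0 + r * x.1 * 0 = x.1
    ring)
  mul_comm x y := Subtype.ext (by
    change x.1 + y.1 + r * x.1 * y.1 = y.1 + x.1 + r * y.1 * x.1
    ring)
  inv_mul_cancel x := Subtype.ext (by
    change -x.1 * (x.2.unit⁻¹ : Aˣ) + x.1 + r * (-x.1 * (x.2.unit⁻¹ : Aˣ)) * x.1 = 0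
    have h := x.2.mul_val_inv
    linear_combination -x.1 * h)

/-- The homomorphism `x ↦ 1 + r x` to the group of units. -/
def toUnits : DeformedUnits r →* Aˣ where
  toFun x := x.2.unit
  map_one' := Units.ext (by
    change 1 + r * 0 = 1
    ring)
  map_mul' x y := Units.ext (by
    change 1 + r * (x.1 + y.1 + r * x.1 * y.1) = (1 + r * x.1) * (1 + r * y.1)
    ring)

/-- Change of rings. -/
def map (f : A →+* B) {s : B} (h : f r = s) : DeformedUnits r →* DeformedUnits s where
  toFun x := ⟨f x.1, by simpa [h] using x.2.map f⟩
  map_one' := Subtype.ext (map_zero f)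
  map_mul' x y := Subtype.ext (by
    change f (x.1 + y.1 + r * x.1 * y.1) = f x.1 + f y.1 + s * f x.1 * f y.1
    simp [h])

end DeformedUnits


/-! ### Morphisms to affine schemes -/

/-- The ring homomorphism attached to a morphism to an affine scheme. -/
def sectionsHom {T : Scheme.{0}} {R : Type} [CommRing R] (f : T ⟶ Spec (CommRingCat.of R)) :
    R →+* Γ(T, ⊤) :=
  f.appTop.hom.comp (Scheme.ΓSpecIso (CommRingCat.of R)).inv.hom

theorem sectionsHom_comp {T T' : Scheme.{0}} {R : Type} [CommRing R] (g : T' ⟶ T)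
    (f : T ⟶ Spec (CommRingCat.of R)) :
    sectionsHom (g ≫ f) = g.appTop.hom.comp (sectionsHom f) := rfl

theorem sectionsHom_id (R : Type) [CommRing R] :
    sectionsHom (𝟙 (Spec (CommRingCat.of R))) =
      (Scheme.ΓSpecIso (CommRingCat.of R)).inv.hom := by
  ext x
  simp [sectionsHom]

theorem sectionsHom_comp_SpecMap {T : Scheme.{0}} {R R' : Type} [CommRing R] [CommRing R']
    (f : T ⟶ Spec (CommRingCat.of R')) (φ : R →+* R') :
    sectionsHom (f ≫ Spec.map (CommRingCat.ofHom φ)) = (sectionsHom f).comp φ := by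
  ext x
  have h := ConcreteCategory.congr_hom
    (Scheme.ΓSpecIso_inv_naturality (CommRingCat.ofHom φ)) x
  simp only [sectionsHom, Scheme.Hom.comp_appTop]
  exact (congrArg f.appTop h).symm

/-- The adjunction between global sections and `Spec`. -/
theorem sectionsHom_bijective (T : Scheme.{0}) (R : Type) [CommRing R] :
    Function.Bijective (sectionsHom : (T ⟶ Spec (CommRingCat.of R)) → (R →+* Γ(T, ⊤))) := by
  constructor
  · intro f g h
    apply (ΓSpec.adjunction.homEquiv _ _).symm.injective
    apply Quiver.Hom.unop_inj
    rw [Adjunction.homEquiv_symm_apply, Adjunction.homEquiv_symm_apply]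
    exact CommRingCat.hom_ext h
  · intro φ
    refine ⟨T.toSpecΓ ≫ Spec.map (CommRingCat.ofHom φ), ?_⟩
    ext x
    simp [sectionsHom]

/-! ### The function `Λ` -/

theorem lam_eq (T : Over affineLine) : lam T = sectionsHom T.hom Polynomial.X := rfl

theorem appTop_lam {T T' : Over affineLine} (g : T' ⟶ T) : g.left.appTop (lam T) = lam T' := by
  rw [lam_eq, lam_eq, ← Over.w g, sectionsHom_comp]
  rfl

theorem sectionsHom_origin : sectionsHom origin =
    (Scheme.ΓSpecIso (CommRingCat.of ℤ)).inv.hom.comp (Polynomial.evalRingHom (0 : ℤ)) := by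
  rw [origin, ← Category.id_comp (Spec.map _), sectionsHom_comp_SpecMap,
    sectionsHom_id]

theorem fst_appTop_lam (U : Over affineLine) :
    (pullback.fst U.hom origin).appTop (lam U) = 0 := by
  have h := sectionsHom_comp (pullback.fst U.hom origin) U.hom
  rw [pullback.condition, sectionsHom_comp, sectionsHom_origin] at h
  have h' := (DFunLike.congr_fun h Polynomial.X).symm
  simpa [lam_eq] using h'

/-- A morphism along which `Λ` vanishes factors through the fibre over the origin. -/
theorem exists_lift_fibre (U : Over affineLine) {Y : Scheme.{0}} (g : Y ⟶ U.left)
    (hg : g.appTop (lam U) = 0) :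
    ∃ l : Y ⟶ pullback U.hom origin, l ≫ pullback.fst U.hom origin = g := by
  obtain ⟨k, hk⟩ := (sectionsHom_bijective Y ℤ).2 (Int.castRingHom _)
  refine ⟨pullback.lift g k ((sectionsHom_bijective Y (Polynomial ℤ)).1 ?_),
    pullback.lift_fst _ _ _⟩
  apply Polynomial.ringHom_ext'
  · exact RingHom.ext_int _ _
  · rw [sectionsHom_comp, sectionsHom_comp, sectionsHom_origin]
    refine Eq.trans (show _ = g.appTop (lam U) from rfl) (hg.trans ?_)
    simp

/-- The test morphism is `Spec (Γ/Λ) ⟶ U`: it kills `Λ`, so it factors through the fibre, and `s`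
vanishes in `Γ/Λ`. -/
theorem dvd_of_fst_appTop_eq_zero (U : Over affineLine) [IsAffine U.left] (s : Γ(U.left, ⊤))
    (hs : (pullback.fst U.hom origin).appTop s = 0) : lam U ∣ s := by
  let q : Γ(U.left, ⊤) ⟶ CommRingCat.of (Γ(U.left, ⊤) ⧸ Ideal.span {lam U}) :=
    CommRingCat.ofHom (Ideal.Quotient.mk _)
  let g : Spec (CommRingCat.of (Γ(U.left, ⊤) ⧸ Ideal.span {lam U})) ⟶ U.left :=
    Spec.map q ≫ U.left.isoSpec.inv
  have hinv : U.left.isoSpec.inv.appTop = (Scheme.ΓSpecIso Γ(U.left, ⊤)).inv := by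
    rw [← cancel_mono (Scheme.ΓSpecIso Γ(U.left, ⊤)).hom, Iso.inv_hom_id,
      ← Scheme.toSpecΓ_appTop, ← Scheme.Hom.comp_appTop, Scheme.toSpecΓ_isoSpec_inv,
      Scheme.Hom.id_appTop]
  have hgt (a : Γ(U.left, ⊤)) : g.appTop a = (Scheme.ΓSpecIso _).inv (q a) := by
    rw [Scheme.Hom.comp_appTop, hinv, ← Scheme.ΓSpecIso_inv_naturality]
    rfl
  have hq (a : Γ(U.left, ⊤)) : g.appTop a = 0 ↔ lam U ∣ a := by
    rw [hgt, ← Ideal.mem_span_singleton, ← Ideal.Quotient.eq_zero_iff_mem]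
    exact map_eq_zero_iff _ (ConcreteCategory.bijective_of_isIso
      (Scheme.ΓSpecIso (CommRingCat.of (Γ(U.left, ⊤) ⧸ Ideal.span {lam U}))).inv).1
  obtain ⟨l, hl⟩ := exists_lift_fibre U g ((hq _).2 dvd_rfl)
  rw [← hq, ← hl, Scheme.Hom.comp_appTop, CommRingCat.comp_apply, hs, map_zero]

theorem isClosedImmersion_origin : IsClosedImmersion origin :=
  IsClosedImmersion.spec_of_surjective _ fun n => ⟨Polynomial.C n, Polynomial.eval_C⟩

theorem fst_appTop_surjective (U : Over affineLine) [IsAffine U.left] :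
    Function.Surjective (pullback.fst U.hom origin).appTop := by
  have := isClosedImmersion_origin
  exact (IsClosedImmersion.isAffine_surjective_of_isAffine _).2

/-- The variable is a nonzerodivisor in `ℤ[Λ]`, and flatness preserves this. Exactness on the left
fails without it. -/
theorem isRegular_lam (U : Over affineLine) [IsAffine U.left] [Flat U.hom] :
    IsLeftRegular (lam U) := by
  have h1 : (sectionsHom U.hom).Flat :=
    RingHom.Flat.comp (RingHom.Flat.of_bijective
      (ConcreteCategory.bijective_of_isIso (Scheme.ΓSpecIso (CommRingCat.of (Polynomial ℤ))).inv))
      U.hom.flat_appTop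
  algebraize [sectionsHom U.hom]
  have h2 := Module.Flat.isSMulRegular_of_isRegular (M := Γ(U.left, ⊤))
    (Polynomial.isRegular_X (R := ℤ))
  intro a b hab
  have ha (c : Γ(U.left, ⊤)) : (Polynomial.X : Polynomial ℤ) • c = lam U * c :=
    Algebra.smul_def _ _
  exact h2 ((ha a).trans (hab.trans (ha b).symm))

/-! ### Flatness -/

theorem flat_GLambda : Flat GLambda.hom := by
  refine Flat.SpecMap_iff.2 ?_
  change (algebraMap (Polynomial ℤ) GLambdaRing).Flat
  rw [RingHom.flat_algebraMap_iff]
  exact Module.Flat.trans (Polynomial ℤ) (Polynomial (Polynomial ℤ)) GLambdaRing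

/-- Affine space is the base change to `S` of the spectrum of a polynomial ring, free over the
integers. -/
theorem flat_wittScheme (S : Scheme.{0}) : Flat (wittScheme S).hom := by
  have h : terminal.from (Spec (CommRingCat.of (MvPolynomial ℕ (ULift.{0} ℤ)))) =
      Spec.map (CommRingCat.ofHom MvPolynomial.C) ≫ terminal.from _ := terminal.hom_ext _ _
  have := isIso_of_isTerminal specULiftZIsTerminal.{0} terminalIsTerminal (terminal.from _)
  have h2 : Flat (Spec.map (CommRingCat.ofHom
      (MvPolynomial.C : ULift.{0} ℤ →+* MvPolynomial ℕ (ULift.{0} ℤ)))) := by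
    refine Flat.SpecMap_iff.2 ?_
    change (algebraMap (ULift.{0} ℤ) (MvPolynomial ℕ (ULift.{0} ℤ))).Flat
    rw [RingHom.flat_algebraMap_iff]
    infer_instance
  have h3 : Flat (terminal.from (Spec (CommRingCat.of (MvPolynomial ℕ (ULift.{0} ℤ))))) := by
    rw [h]
    infer_instance
  exact inferInstanceAs (Flat (pullback.fst (terminal.from S) (terminal.from
    (Spec (CommRingCat.of (MvPolynomial ℕ (ULift.{0} ℤ)))))))

/-! ### Representability -/

/-- The multiplicative group is a sheaf, being represented by `Spec ℤ[X, 1/X]`. -/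
theorem multiplicativeGroup_isSheaf : Presieve.IsSheaf (Scheme.grothendieckTopology FlatLFP)
    (multiplicativeGroup ⋙ forget AddCommGrpCat) := by
  let R := Localization.Away (Polynomial.X : Polynomial ℤ)
  let x : R := algebraMap (Polynomial ℤ) R Polynomial.X
  have hx : IsUnit x := IsLocalization.Away.algebraMap_isUnit _
  let e (T : Scheme.{0}) (f : T ⟶ Spec (CommRingCat.of R)) : Additive (Γ(T, ⊤))ˣ :=
    Additive.ofMul (hx.map (sectionsHom f)).unit
  have he (T : Scheme.{0}) : Function.Bijective (e T) := by
    constructor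
    · intro f g h
      refine (sectionsHom_bijective T R).1 ?_
      refine IsLocalization.ringHom_ext (Submonoid.powers (Polynomial.X : Polynomial ℤ)) ?_
      refine Polynomial.ringHom_ext' (RingHom.ext_int _ _) ?_
      exact congrArg (fun u : Additive (Γ(T, ⊤))ˣ => (u.toMul : Γ(T, ⊤))) h
    · intro u
      have hu : IsUnit (Polynomial.eval₂RingHom (Int.castRingHom Γ(T, ⊤)) (u.toMul : Γ(T, ⊤))
          Polynomial.X) := by
        rw [Polynomial.coe_eval₂RingHom, Polynomial.eval₂_X]
        exact Units.isUnit _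
      obtain ⟨f, hf⟩ := (sectionsHom_bijective T R).2 (IsLocalization.Away.lift _ hu)
      refine ⟨f, Additive.toMul.injective (Units.ext ?_)⟩
      change sectionsHom f x = _
      rw [hf]
      exact (IsLocalization.Away.lift_eq _ hu _).trans (Polynomial.eval₂_X _ _)
  refine isSheaf_of_representableBy (X := Spec (CommRingCat.of R))
    { homEquiv := fun {T} => Equiv.ofBijective (e T) (he T)
      homEquiv_comp := fun {T T'} f g => Additive.toMul.injective (Units.ext ?_) }
  exact DFunLike.congr_fun (sectionsHom_comp f g) x

theorem wittGroup_isSheaf (p : ℕ) [Fact p.Prime] :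
    Presieve.IsSheaf (Scheme.grothendieckTopology FlatLFP)
      (wittGroup p ⋙ forget AddCommGrpCat) :=
  isSheaf_of_representableBy (X := Spec (CommRingCat.of (MvPolynomial ℕ (ULift.{0} ℤ))))
    { homEquiv := fun {T} => (AffineSpace.toSpecMvPolyIntEquiv ℕ).trans
        ⟨WittVector.mk p, WittVector.coeff, fun _ => rfl, fun _ => rfl⟩
      homEquiv_comp := fun {T T'} f g => by
        apply WittVector.ext
        intro n
        refine (AffineSpace.toSpecMvPolyIntEquiv_comp ℕ f g n).trans ?_
        exact (WittVector.map_coeff f.appTop.hom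
          (WittVector.mk p (AffineSpace.toSpecMvPolyIntEquiv ℕ g)) n).symm }


open scoped MonObj

/-! ### The group scheme `𝒢^Λ` -/

theorem GLambda.sectionsHom_comp_algebraMap {T : Over affineLine} (x : T ⟶ GLambda) :
    (sectionsHom x.left).comp (algebraMap (Polynomial ℤ) GLambdaRing) = sectionsHom T.hom := by
  rw [← Over.w x]
  exact (sectionsHom_comp_SpecMap _ _).symm

theorem GLambda.one_add_eq {T : Over affineLine} (x : T ⟶ GLambda) :
    1 + lam T * GLambda.coord x = sectionsHom x.left (algebraMap _ _
      (1 + Polynomial.C Polynomial.X * Polynomial.X : Polynomial (Polynomial ℤ))) := by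
  have h := DFunLike.congr_fun (GLambda.sectionsHom_comp_algebraMap x) Polynomial.X
  rw [map_add, map_mul, map_add, map_mul, map_one, map_one, lam_eq, ← h]
  rfl

/-- The element of `DeformedUnits (lam T)` attached to a point of `𝒢^Λ`. -/
def GLambda.toDeformedUnits {T : Over affineLine} (x : T ⟶ GLambda) : DeformedUnits (lam T) :=
  ⟨GLambda.coord x, by
    rw [GLambda.one_add_eq]
    exact (IsLocalization.Away.algebraMap_isUnit _).map (sectionsHom x.left)⟩

/-- The universal properties of polynomial rings and localisation: a point is a value of `X` making
`1 + ΛX` invertible. -/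
theorem GLambda.toDeformedUnits_bijective (T : Over affineLine) :
    Function.Bijective (GLambda.toDeformedUnits (T := T)) := by
  constructor
  · intro x y h
    apply Over.OverMorphism.ext
    refine (sectionsHom_bijective T.left GLambdaRing).1 ?_
    refine IsLocalization.ringHom_ext (Submonoid.powers
      (1 + Polynomial.C Polynomial.X * Polynomial.X : Polynomial (Polynomial ℤ))) ?_
    refine Polynomial.ringHom_ext' ?_ (congrArg Subtype.val h)
    exact (GLambda.sectionsHom_comp_algebraMap x).trans
      (GLambda.sectionsHom_comp_algebraMap y).symm
  · rintro ⟨a, ha⟩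
    have hu : IsUnit (Polynomial.eval₂RingHom (sectionsHom T.hom) a
        (1 + Polynomial.C Polynomial.X * Polynomial.X)) := by
      simpa [lam_eq] using ha
    obtain ⟨f, hf⟩ := (sectionsHom_bijective T.left GLambdaRing).2 (IsLocalization.Away.lift _ hu)
    have hw : f ≫ GLambda.hom = T.hom := by
      refine (sectionsHom_bijective T.left (Polynomial ℤ)).1 ?_
      refine (sectionsHom_comp_SpecMap _ _).trans ?_
      rw [hf]
      ext q
      · simp
      · refine (IsLocalization.Away.lift_eq _ hu (Polynomial.C Polynomial.X)).trans ?_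
        exact Polynomial.eval₂_C _ _
    refine ⟨Over.homMk f hw, Subtype.ext ?_⟩
    change sectionsHom f _ = a
    rw [hf]
    exact (IsLocalization.Away.lift_eq _ hu Polynomial.X).trans (Polynomial.eval₂_X _ _)

/-- The presheaf of groups `T ↦ {x | 1 + Λ x is invertible}`. -/
def deformedUnits : (Over affineLine)ᵒᵖ ⥤ CommGrpCat.{0} where
  obj T := CommGrpCat.of (DeformedUnits (lam T.unop))
  map f := CommGrpCat.ofHom (DeformedUnits.map f.unop.left.appTop.hom (appTop_lam f.unop))
  map_id T := by
    ext x
    exact Subtype.ext (by simp [DeformedUnits.map]; rfl)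
  map_comp f g := by
    ext x
    exact Subtype.ext (by simp [DeformedUnits.map]; rfl)

/-- `𝒢^Λ` represents the presheaf `T ↦ {x | 1 + Λ x is invertible}`. -/
def GLambda.representableBy : (deformedUnits ⋙ forget CommGrpCat).RepresentableBy GLambda where
  homEquiv {T} := Equiv.ofBijective _ (GLambda.toDeformedUnits_bijective T)
  homEquiv_comp _ _ := Subtype.ext rfl

/-- The group scheme structure on `𝒢^Λ`. -/
instance GLambda.commGrpObj : CommGrpObj GLambda :=
  CommGrpObj.ofRepresentableBy GLambda deformedUnits GLambda.representableBy

theorem GLambda.toDeformedUnits_mul {T : Over affineLine} (x y : T ⟶ GLambda) :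
    GLambda.toDeformedUnits (x * y) = GLambda.toDeformedUnits x * GLambda.toDeformedUnits y :=
  ((yonedaMonObjIsoOfRepresentableBy GLambda
    (deformedUnits ⋙ forget₂ CommGrpCat CommMonCat ⋙ forget₂ CommMonCat MonCat)
    GLambda.representableBy).hom.app (op T)).hom.map_mul x y

/-- The homomorphism `x ↦ 1 + Λ x` from `𝒢^Λ` to the multiplicative group. -/
def alphaLambda :
    pointsOfGroupScheme GLambda ⟶ overBase affineLine multiplicativeGroup where
  app T := AddCommGrpCat.ofHom (AddMonoidHom.mk'
    (fun x => Additive.ofMul (DeformedUnits.toUnits (GLambda.toDeformedUnits x.toMul)))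
    fun x y => congrArg Additive.ofMul
      ((congrArg _ (GLambda.toDeformedUnits_mul x.toMul y.toMul)).trans
        ((DeformedUnits.toUnits (r := lam T.unop)).map_mul _ _)))
  naturality T T' f := by
    ext x
    refine Additive.toMul.injective (Units.ext ?_)
    change 1 + lam T'.unop * f.unop.left.appTop (GLambda.coord x.toMul) =
      f.unop.left.appTop (1 + lam T.unop * GLambda.coord x.toMul)
    rw [map_add, map_mul, map_one, appTop_lam]

theorem alphaLambda_apply (T : Over affineLine) (x : T ⟶ GLambda) :
    ((Additive.toMul (alphaLambda.app (op T) (Additive.ofMul x)) : (Γ(T.left, ⊤))ˣ) :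
      Γ(T.left, ⊤)) = 1 + lam T * GLambda.coord x := rfl

theorem pointsOfGroupScheme_isSheaf :
    Presieve.IsSheaf (affineLine.overGrothendieckTopology FlatLFP)
      (pointsOfGroupScheme GLambda ⋙ forget AddCommGrpCat) :=
  isSheaf_of_representableBy (X := GLambda)
    { homEquiv := fun {_} => Additive.ofMul
      homEquiv_comp := fun _ _ => rfl }

/-! ### The `W`-module scheme `W^Λ` -/

variable (p : ℕ)

/-- The components of a point of `W`, as coordinates on `W^Λ`. -/
def scaledPoints (T : Over affineLine) : (T ⟶ wittScheme affineLine) ≃ ScaledWitt p (lam T) :=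
  (wittPoints p T).trans ⟨WittVector.coeff, WittVector.mk p, fun _ => rfl, fun _ => rfl⟩

theorem scaledPoints_comp {T T' : Over affineLine} (g : T' ⟶ T) (x : T ⟶ wittScheme affineLine) :
    scaledPoints p T' (g ≫ x) =
      ScaledWitt.map g.left.appTop.hom (appTop_lam g) (scaledPoints p T x) := rfl

variable [Fact p.Prime]

theorem scale_scaledPoints {T : Over affineLine} (x : T ⟶ wittScheme affineLine) :
    (scaledPoints p T x).scale = wittPoints p T (x ≫ lambdaMul) := by
  ext n
  exact (wittPoints_comp_lambdaMul p x n).symm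

/-- The `W`-module scheme structure on `W^Λ`. -/
def wittModuleScheme : WittModuleScheme p (wittScheme affineLine) where
  addCommGroup T := (scaledPoints p T).addCommGroup
  module T :=
    letI := (scaledPoints p T).addCommGroup
    (scaledPoints p T).module (WittVector p Γ(T.left, ⊤))
  comp_add {T T'} g x y := by
    let := (scaledPoints p T).addCommGroup
    let := (scaledPoints p T').addCommGroup
    apply (scaledPoints p T').injective
    rw [scaledPoints_comp, Equiv.add_def, Equiv.add_def, Equiv.apply_symm_apply,
      Equiv.apply_symm_apply, ScaledWitt.map_add]
    rfl
  comp_smul {T T'} g a x := by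
    let := (scaledPoints p T).addCommGroup
    let := (scaledPoints p T').addCommGroup
    let := (scaledPoints p T).module (WittVector p Γ(T.left, ⊤))
    let := (scaledPoints p T').module (WittVector p Γ(T'.left, ⊤))
    apply (scaledPoints p T').injective
    rw [scaledPoints_comp, Equiv.smul_def, Equiv.smul_def, Equiv.apply_symm_apply,
      Equiv.apply_symm_apply, ScaledWitt.map_smul]
    rfl

theorem wittPoints_add {T : Over affineLine} (x y : T ⟶ wittScheme affineLine) :
    letI := (wittModuleScheme p).addCommGroup T
    wittPoints p T ((x + y) ≫ lambdaMul) =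
      wittPoints p T (x ≫ lambdaMul) + wittPoints p T (y ≫ lambdaMul) := by
  let := (scaledPoints p T).addCommGroup
  change wittPoints p T ((x + y) ≫ lambdaMul) = _
  rw [← scale_scaledPoints, ← scale_scaledPoints, ← scale_scaledPoints, Equiv.add_def,
    Equiv.apply_symm_apply, ScaledWitt.scale_add]

theorem wittPoints_smul {T : Over affineLine} (a : WittVector p Γ(T.left, ⊤))
    (x : T ⟶ wittScheme affineLine) :
    letI := (wittModuleScheme p).addCommGroup T
    letI := (wittModuleScheme p).module T
    wittPoints p T ((a • x) ≫ lambdaMul) = a * wittPoints p T (x ≫ lambdaMul) := by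
  let := (scaledPoints p T).addCommGroup
  let := (scaledPoints p T).module (WittVector p Γ(T.left, ⊤))
  change wittPoints p T ((a • x) ≫ lambdaMul) = _
  rw [← scale_scaledPoints, ← scale_scaledPoints, Equiv.smul_def,
    Equiv.apply_symm_apply, ScaledWitt.scale_smul]

/-- Multiplication by `Λ`, as a homomorphism from `W^Λ` to `W`. -/
def betaLambda : (wittModuleScheme p).points ⟶ overBase affineLine (wittGroup p) :=
  letI := (wittModuleScheme p).addCommGroup
  { app := fun T => AddCommGrpCat.ofHom (AddMonoidHom.mk'
      (fun x : T.unop ⟶ wittScheme affineLine => wittPoints p T.unop (x ≫ lambdaMul))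
      (wittPoints_add p))
    naturality := fun T T' f => by
      ext x
      exact WittVector.ext fun n => congrArg (fun y => (wittPoints p T'.unop y).coeff n)
        (Category.assoc f.unop x lambdaMul) }

theorem wittModuleScheme_isSheaf :
    Presieve.IsSheaf (affineLine.overGrothendieckTopology FlatLFP)
      ((wittModuleScheme p).points ⋙ forget AddCommGrpCat) :=
  isSheaf_of_representableBy (X := wittScheme affineLine)
    { homEquiv := fun {_} => Equiv.refl _
      homEquiv_comp := fun _ _ => rfl }


/-! ### Exactness -/

/-- The base change of an open immersion to the fibre along `i`. -/
def fibreOpen {Z S : Scheme.{0}} (i : Z ⟶ S) (U : Over S) (V : U.left.Opens) :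
    pullback (V.ι ≫ U.hom) i ⟶ pullback U.hom i :=
  pullback.lift (pullback.fst _ _ ≫ V.ι) (pullback.snd _ _) (by
    rw [Category.assoc, pullback.condition])

theorem fibreOpen_fst {Z S : Scheme.{0}} (i : Z ⟶ S) (U : Over S) (V : U.left.Opens) :
    fibreOpen i U V ≫ pullback.fst U.hom i = pullback.fst (V.ι ≫ U.hom) i ≫ V.ι :=
  pullback.lift_fst _ _ _

/-- Exactness of `0 ⟶ F ⟶ G ⟶ i_* G ⟶ 0` may be checked on affine schemes. -/
theorem isShortExactSequenceOfSheaves_of_affine {Z S : Scheme.{0}} (i : Z ⟶ S)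
    {F : (Over S)ᵒᵖ ⥤ AddCommGrpCat.{0}} {G : Scheme.{0}ᵒᵖ ⥤ AddCommGrpCat.{0}}
    (f : F ⟶ overBase S G)
    (hF : Presieve.IsSheaf (S.overGrothendieckTopology FlatLFP) (F ⋙ forget AddCommGrpCat))
    (hG : Presieve.IsSheaf (Scheme.grothendieckTopology FlatLFP) (G ⋙ forget AddCommGrpCat))
    (hinj : ∀ U : Over S, IsAffine U.left → Flat U.hom → Function.Injective (f.app (op U)))
    (hex : ∀ U : Over S, IsAffine U.left → Flat U.hom → ∀ y : G.obj (op U.left),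
      G.map (pullback.fst U.hom i).op y = 0 ↔ ∃ x, f.app (op U) x = y)
    (hsurj : ∀ U : Over S, IsAffine U.left → Flat U.hom → ∀ y : G.obj (op (pullback U.hom i)),
      ∀ x : U.left, ∃ V : U.left.Opens, x ∈ V ∧ ∃ s : G.obj (op V.toScheme),
        G.map (pullback.fst (V.ι ≫ U.hom) i).op s = G.map (fibreOpen i U V).op y) :
    IsShortExactSequenceOfSheaves (flatTopology S) (restrictFlatMap f) (toDirectImage i G) := by
  refine .of_basis _ _ (restrictFlat_isSheaf F hF) (restrictFlat_isSheaf _ (overBase_isSheaf S G hG))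
    (directImage_isSheaf i G hG) (fun U => IsAffine U.left) exists_affine_cover ?_ ?_ ?_
  · intro U hU x y hxy
    exact ULift.down_injective (hinj U.toComma hU U.prop.1 (congrArg ULift.down hxy))
  · intro U hU y
    refine Iff.trans ?_ ((hex U.toComma hU U.prop.1 y.down).trans ?_)
    · exact ⟨fun h => congrArg ULift.down h, fun h => ULift.down_injective h⟩
    · exact ⟨fun ⟨x, hx⟩ => ⟨ULift.up x, ULift.down_injective hx⟩,
        fun ⟨x, hx⟩ => ⟨x.down, congrArg ULift.down hx⟩⟩
  · intro U hU y
    refine mem_flatTopology _ fun x => ?_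
    obtain ⟨V, hxV, s, hs⟩ := hsurj U.toComma hU U.prop.1 y.down x
    refine ⟨restrictOpen U V, restrictOpenHom U V, inferInstanceAs (IsOpenImmersion V.ι),
      ⟨⟨x, hxV⟩, rfl⟩, ULift.up s, ULift.down_injective hs⟩

theorem eq_appTop_fibreOpen (U : Over affineLine) (V : U.left.Opens)
    (b : Γ(U.left, ⊤)) :
    (pullback.fst (V.ι ≫ U.hom) origin).appTop (V.ι.appTop b) =
      (fibreOpen origin U V).appTop ((pullback.fst U.hom origin).appTop b) := by
  exact (congrArg (fun k => (Scheme.Hom.appTop k).hom b) (fibreOpen_fst origin U V)).symm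

theorem isUnit_ι_appTop {X : Scheme.{0}} (b : Γ(X, ⊤)) :
    IsUnit ((X.basicOpen b).ι.appTop b) := by
  have h := (RingedSpace.isUnit_res_basicOpen X.toRingedSpace b).map
    (X.presheaf.map (homOfLE (X.basicOpen b).ι_image_top.le).op).hom
  have e := X.presheaf.map_comp (homOfLE (X.basicOpen_le b)).op
    (homOfLE (X.basicOpen b).ι_image_top.le).op
  exact (congrArg (fun k => IsUnit (k.hom b)) e).mpr h

/-- The stalk at `x` is local, so one of two germs with sum `1` is a unit. -/
theorem mem_basicOpen_or {U : Scheme.{0}} {b c d e : Γ(U, ⊤)} (h : b * c + d * e = 1) (x : U) :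
    x ∈ U.basicOpen b ∨ x ∈ U.basicOpen d := by
  rw [Scheme.mem_basicOpen_top, Scheme.mem_basicOpen_top]
  have h' := congrArg (U.presheaf.germ ⊤ x trivial) h
  rw [map_add, map_mul, map_mul, map_one] at h'
  exact (IsLocalRing.isUnit_or_isUnit_of_add_one h').imp isUnit_of_mul_isUnit_left
    isUnit_of_mul_isUnit_left

theorem exact_GLambda :
    IsShortExactSequenceOfSheaves (flatTopology affineLine)
      (restrictFlatMap alphaLambda) (toDirectImage origin multiplicativeGroup) := by
  refine isShortExactSequenceOfSheaves_of_affine origin alphaLambda pointsOfGroupScheme_isSheaf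
    multiplicativeGroup_isSheaf ?_ ?_ ?_
  · intro U hU hflat x y hxy
    have h : 1 + lam U * GLambda.coord (Additive.toMul x) =
        1 + lam U * GLambda.coord (Additive.toMul y) :=
      congrArg (fun u : Additive (Γ(U.left, ⊤))ˣ => (u.toMul : Γ(U.left, ⊤))) hxy
    exact Additive.toMul.injective ((GLambda.toDeformedUnits_bijective U).1
      (Subtype.ext (isRegular_lam U (add_left_cancel h))))
  · intro U hU hflat (y : Additive (Γ(U.left, ⊤))ˣ)
    have key : multiplicativeGroup.map (pullback.fst U.hom origin).op y = 0 ↔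
        (pullback.fst U.hom origin).appTop (y.toMul : Γ(U.left, ⊤)) = 1 :=
      ⟨fun h => congrArg (fun u : Additive (Γ(pullback U.hom origin, ⊤))ˣ =>
        (u.toMul : Γ(pullback U.hom origin, ⊤))) h,
        fun h => Additive.toMul.injective (Units.ext h)⟩
    rw [key]
    constructor
    · intro h
      obtain ⟨a, ha⟩ := dvd_of_fst_appTop_eq_zero U ((y.toMul : Γ(U.left, ⊤)) - 1)
        (by rw [map_sub, h, map_one, sub_self])
      have ha' : 1 + lam U * a = (y.toMul : Γ(U.left, ⊤)) := by
        rw [← ha]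
        ring
      obtain ⟨x, hx⟩ := (GLambda.toDeformedUnits_bijective U).2
        ⟨a, by rw [ha']; exact Units.isUnit _⟩
      refine ⟨Additive.ofMul x, Additive.toMul.injective (Units.ext ?_)⟩
      refine Eq.trans ?_ ha'
      exact congrArg (fun t => 1 + lam U * t) (congrArg Subtype.val hx)
    · rintro ⟨x, rfl⟩
      change (pullback.fst U.hom origin).appTop (1 + lam U * GLambda.coord (Additive.toMul x)) = 1
      rw [map_add, map_mul, fst_appTop_lam, zero_mul, map_one, add_zero]
  · intro U hU hflat (y : Additive (Γ(pullback U.hom origin, ⊤))ˣ) x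
    obtain ⟨b, hb⟩ := fst_appTop_surjective U (y.toMul : Γ(pullback U.hom origin, ⊤))
    obtain ⟨c, hc⟩ := fst_appTop_surjective U
      ((y.toMul⁻¹ : (Γ(pullback U.hom origin, ⊤))ˣ) : Γ(pullback U.hom origin, ⊤))
    -- The lifts `b`, `c` are inverse modulo `Λ`, so `D(b)` and `D(Λ)` cover `U`.
    obtain ⟨d, hd⟩ := dvd_of_fst_appTop_eq_zero U (1 - b * c)
      (by rw [map_sub, map_mul, map_one, hb, hc, Units.mul_inv, sub_self])
    rcases mem_basicOpen_or (b := b) (c := c) (d := lam U) (e := d) (by rw [← hd]; ring) x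
      with hx | hx
    · refine ⟨_, hx, Additive.ofMul (isUnit_ι_appTop b).unit,
        Additive.toMul.injective (Units.ext ?_)⟩
      refine (eq_appTop_fibreOpen U _ b).trans ?_
      rw [hb]
      rfl
    -- Over `D(Λ)` the function `Λ` is both zero and invertible on the fibre, whose ring is
    -- therefore zero; any section lifts, here the neutral one.
    · refine ⟨_, hx, 0, Additive.toMul.injective (Units.ext ?_)⟩
      have h1 := (isUnit_ι_appTop (lam U)).map
        (pullback.fst ((U.left.basicOpen (lam U)).ι ≫ U.hom) origin).appTop.hom
      have h2 := eq_appTop_fibreOpen U (U.left.basicOpen (lam U)) (lam U)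
      rw [fst_appTop_lam, map_zero] at h2
      have h3 := isUnit_zero_iff.1 (h2 ▸ h1)
      exact (subsingleton_of_zero_eq_one h3).elim _ _

theorem exact_wittScheme (p : ℕ) [Fact p.Prime] :
    IsShortExactSequenceOfSheaves (flatTopology affineLine)
      (restrictFlatMap (betaLambda p)) (toDirectImage origin (wittGroup p)) := by
  refine isShortExactSequenceOfSheaves_of_affine origin (betaLambda p) (wittModuleScheme_isSheaf p)
    (wittGroup_isSheaf p) ?_ ?_ ?_
  · intro U hU hflat x y hxy
    apply (scaledPoints p U).injective
    apply ScaledWitt.scale_injective (isRegular_lam U)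
    exact (scale_scaledPoints p _).trans (hxy.trans (scale_scaledPoints p _).symm)
  · intro U hU hflat (y : WittVector p Γ(U.left, ⊤))
    have key : (wittGroup p).map (pullback.fst U.hom origin).op y = 0 ↔
        ∀ n, (pullback.fst U.hom origin).appTop (WittVector.coeff y n) = 0 := by
      refine WittVector.ext_iff.trans (forall_congr' fun n => ?_)
      exact Iff.of_eq (congrArg₂ (· = ·) (WittVector.map_coeff
        (pullback.fst U.hom origin).appTop.hom y n) (WittVector.zero_coeff p _ n))
    rw [key]
    constructor
    · intro h
      choose a ha using fun n => dvd_of_fst_appTop_eq_zero U _ (h n)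
      refine ⟨(scaledPoints p U).symm a, ?_⟩
      refine (scale_scaledPoints p _).symm.trans ?_
      refine (congrArg ScaledWitt.scale ((scaledPoints p U).apply_symm_apply a)).trans ?_
      exact WittVector.ext fun n => (ha n).symm
    · rintro ⟨x, rfl⟩ n
      refine Eq.trans (congrArg _ (wittPoints_comp_lambdaMul p x n)) ?_
      rw [map_mul, fst_appTop_lam, zero_mul]
  · intro U hU hflat (y : WittVector p Γ(pullback U.hom origin, ⊤)) x
    choose b hb using fun n => fst_appTop_surjective U (WittVector.coeff y n)
    -- No localisation is needed: arbitrary lifts of the components already form a Witt vector over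
    -- all of `U`.
    refine ⟨⊤, trivial, WittVector.mk p fun n => (⊤ : U.left.Opens).ι.appTop (b n), ?_⟩
    refine WittVector.ext fun n => ?_
    refine (eq_appTop_fibreOpen U ⊤ (b n)).trans ?_
    rw [hb]
    rfl

end

end FlatSheaves

open FlatSheaves in
theorem proposition2p3p1 (p : ℕ) [Fact p.Prime] :
    (Flat GLambda.hom ∧
      ∃ (_ : CommGrpObj GLambda)
        (α : pointsOfGroupScheme GLambda ⟶ overBase affineLine multiplicativeGroup),
        (∀ (T : Over affineLine) (x : T ⟶ GLambda),
          ((Additive.toMul (α.app (op T) (Additive.ofMul x)) : (Γ(T.left, ⊤))ˣ) : Γ(T.left, ⊤)) =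
            1 + lam T * GLambda.coord x) ∧
        IsShortExactSequenceOfSheaves (flatTopology affineLine)
          (restrictFlatMap α) (toDirectImage origin multiplicativeGroup)) ∧
    (Flat (wittScheme affineLine).hom ∧
      ∃ (m : WittModuleScheme p (wittScheme affineLine))
        (β : m.points ⟶ overBase affineLine (wittGroup p)),
        (∀ (T : Over affineLine) (x : T ⟶ wittScheme affineLine),
          β.app (op T) x = wittPoints p T (x ≫ lambdaMul)) ∧
        (∀ (T : Over affineLine) (a : WittVector p Γ(T.left, ⊤))
          (x : T ⟶ wittScheme affineLine),
          letI := m.addCommGroup T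
          letI := m.module T
          wittPoints p T ((a • x) ≫ lambdaMul) = a * wittPoints p T (x ≫ lambdaMul)) ∧
        IsShortExactSequenceOfSheaves (flatTopology affineLine)
          (restrictFlatMap β) (toDirectImage origin (wittGroup p))) :=
  ⟨⟨flat_GLambda, inferInstance, alphaLambda, alphaLambda_apply, exact_GLambda⟩,
    flat_wittScheme affineLine, wittModuleScheme p, betaLambda p, fun _ _ => rfl,
    fun _ a x => wittPoints_smul p a x, exact_wittScheme p⟩
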